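/- Let $E_{ij}$ ($1\le i,j\le 3$) be the matrix units of $M_3(\mathbb{C})$ and let $$w^-=\sum_{i,j=1}^{3}\varepsilon_{ij}\,E_{ij}\otimes E_{ji},\qquad \varepsilon_{ij}=\begin{cases}1,& i=j,\\ -1,& i\neq j.\end{cases}$$ For $x\in M_3(\mathbb{C})\otimes M_3(\mathbb{C})$ let $$\pi(x)=\inf\Big\{\sum_{i=1}^k\|a_i\|\,\|b_i\|_1 \;:\; k\in\mathbb{N},\ x=\sum_{i=1}^k a_i\otimes b_i,\ a_i,b_i\in M_3(\mathbb{C})\Big\}$$ be the projective norm, where $\|\cdot\|$ is the operator norm and $\|b\|_1=\operatorname{Tr}\,(b^*b)^{1/2}$ is the trace norm, and let $$\alpha(\rho)=\sup\Big\{\frac{|\operatorname{Tr}\rho a|}{\pi(a)} \;:\; a\in M_3(\mathbb{C})\otimes M_3(\mathbb{C}),\ a\neq 0\Big\}$$ be its dual norm. An operator $\rho$ on $\mathbb{C}^3\otimes\mathbb{C}^3$ is called block positive if $(x\otimes y,\rho\,(x\otimes y))\ge 0$ for all $x,y\in\mathbb{C}^3$. Then $w^-$ is a symmetry (a self-adjoint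 unitary) on $\mathbb{C}^3\otimes\mathbb{C}^3$, it is not block positive, and $\alpha(w^-)=5/3$. -/

import Mathlib

open scoped Kronecker

noncomputable section

section

variable {n : Type*} [Fintype n] [DecidableEq n]

/-- The operator norm of a complex square matrix acting on the Hilbert space `ℂⁿ`. -/
def opNorm (a : Matrix n n ℂ) : ℝ := ‖Matrix.toEuclideanCLM (n := n) (𝕜 := ℂ) a‖

open scoped MatrixOrder in
/-- The trace norm `‖b‖₁ = Tr |b|`, where `|b| = (b* b)^{1/2}` is `CFC.abs b`. -/
def traceNorm (b : Matrix n n ℂ) : ℝ := (CFC.abs b).trace.re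

/-- The projective norm on `M_n ⊗ M_n`, where the first factor carries the operator norm and the
second one the trace norm. The tensor product `M_n ⊗ M_n` is realized, through the Kronecker
product, as the space of matrices indexed by `n × n`. -/
def projNorm (x : Matrix (n × n) (n × n) ℂ) : ℝ :=
  sInf {r : ℝ | ∃ (k : ℕ) (a b : Fin k → Matrix n n ℂ),
    x = ∑ i, a i ⊗ₖ b i ∧ r = ∑ i, opNorm (a i) * traceNorm (b i)}

/-- The norm `α` dual to the projective norm under the trace pairing. -/
def alphaNorm (ρ : Matrix (n × n) (n × n) ℂ) : ℝ :=
  sSup {r : ℝ | ∃ a : Matrix (n × n) (n × n) ℂ, a ≠ 0 ∧ r = ‖(ρ * a).trace‖ / projNorm a}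

/-- A symmetry is a self-adjoint unitary. -/
def IsSymmetry (s : Matrix n n ℂ) : Prop :=
  IsSelfAdjoint s ∧ s ∈ Matrix.unitaryGroup n ℂ

/-- The elementary tensor `x ⊗ y` in `ℂⁿ ⊗ ℂⁿ`. -/
def tensorVec (x y : n → ℂ) : n × n → ℂ := fun p => x p.1 * y p.2

open scoped ComplexOrder in
/-- Block positivity: `(x ⊗ y, ρ (x ⊗ y)) ≥ 0` (a non-negative real number) for all `x`, `y`. -/
def IsBlockPositive (ρ : Matrix (n × n) (n × n) ℂ) : Prop :=
  ∀ x y : n → ℂ, 0 ≤ star (tensorVec x y) ⬝ᵥ (ρ.mulVec (tensorVec x y))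

end

/-- The signed swap `w⁻ = ∑ ε_ij E_ij ⊗ E_ji` on `ℂ³ ⊗ ℂ³`, with `ε_ij = 1` if `i = j` and
`ε_ij = -1` if `i ≠ j`. -/
def wMinus : Matrix (Fin 3 × Fin 3) (Fin 3 × Fin 3) ℂ :=
  ∑ i : Fin 3, ∑ j : Fin 3, (if i = j then (1 : ℂ) else -1) •
    (Matrix.single i j (1 : ℂ) ⊗ₖ Matrix.single j i (1 : ℂ))

end

section TraceDuality

variable {n : Type*} [Fintype n] [DecidableEq n]

/-! Pairing `wMinus` with `a ⊗ b` gives `Tr (F(a) b)`, where `F = flipOffDiag`. By Hölder's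
inequality `norm_trace_mul_le`, `α(w⁻)` is at most the norm of `F` for the operator norm. Now `F(a)
= 2 diag(a) - a`, and `diag` averages the conjugations by `1, u, u*`, with `u` the diagonal matrix
of cube roots of unity, so `‖F‖ ≤ 1/3 + 2/3 + 2/3 = 5/3`. With `P = constProj`, the unitary `2P - 1`
and `b = P` attain the bound, as `F(2P - 1) P = -(5/3) P`. -/

lemma opNorm_nonneg (a : Matrix n n ℂ) : 0 ≤ opNorm a := norm_nonneg _

lemma opNorm_add_le (a b : Matrix n n ℂ) : opNorm (a + b) ≤ opNorm a + opNorm b := by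
  simpa [opNorm] using norm_add_le (Matrix.toEuclideanCLM (n := n) (𝕜 := ℂ) a)
    (Matrix.toEuclideanCLM (n := n) (𝕜 := ℂ) b)

lemma opNorm_smul (c : ℂ) (a : Matrix n n ℂ) : opNorm (c • a) = ‖c‖ * opNorm a := by
  simp [opNorm, norm_smul]

lemma opNorm_mul_le (a b : Matrix n n ℂ) : opNorm (a * b) ≤ opNorm a * opNorm b := by
  simpa [opNorm] using norm_mul_le (Matrix.toEuclideanCLM (n := n) (𝕜 := ℂ) a)
    (Matrix.toEuclideanCLM (n := n) (𝕜 := ℂ) b)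

lemma opNorm_le_one_of_mem_unitaryGroup {u : Matrix n n ℂ}
    (hu : u ∈ Matrix.unitaryGroup n ℂ) : opNorm u ≤ 1 := by
  refine ContinuousLinearMap.opNorm_le_bound _ zero_le_one fun x => ?_
  have h : Matrix.toEuclideanCLM (n := n) (𝕜 := ℂ) u ∈ unitary _ :=
    Unitary.map_mem (Matrix.toEuclideanCLM (n := n) (𝕜 := ℂ)) hu
  rw [one_mul, ContinuousLinearMap.norm_map_of_mem_unitary h]

lemma opNorm_unitary_conj_le {u : Matrix n n ℂ} (hu : u ∈ Matrix.unitaryGroup n ℂ)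
    (a : Matrix n n ℂ) : opNorm (u * a * star u) ≤ opNorm a := by
  have h1 := opNorm_le_one_of_mem_unitaryGroup hu
  have h2 := opNorm_le_one_of_mem_unitaryGroup (Unitary.star_mem hu)
  have h0 := opNorm_nonneg a
  calc opNorm (u * a * star u) ≤ opNorm u * opNorm a * opNorm (star u) :=
        (opNorm_mul_le _ _).trans
          (mul_le_mul_of_nonneg_right (opNorm_mul_le _ _) (opNorm_nonneg _))
    _ ≤ 1 * opNorm a * 1 := by gcongr; exact opNorm_nonneg _
    _ = opNorm a := by ring

open scoped ComplexOrder MatrixOrder in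
lemma traceNorm_of_posSemidef {b : Matrix n n ℂ} (hb : b.PosSemidef) :
    traceNorm b = b.trace.re := by
  rw [traceNorm, CFC.abs_of_nonneg b hb.nonneg]

open scoped ComplexOrder MatrixOrder in
lemma traceNorm_nonneg (b : Matrix n n ℂ) : 0 ≤ traceNorm b :=
  (Complex.le_def.1 (Matrix.nonneg_iff_posSemidef.1 (CFC.abs_nonneg b)).trace_nonneg).1

lemma trace_eq_sum_inner (c : Matrix n n ℂ) (v : OrthonormalBasis n ℂ (EuclideanSpace ℂ n)) :
    c.trace = ∑ i, inner ℂ (v i) (Matrix.toEuclideanCLM (n := n) (𝕜 := ℂ) c (v i)) := by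
  have h := LinearMap.trace_eq_sum_inner
    (Matrix.toEuclideanCLM (n := n) (𝕜 := ℂ) c : EuclideanSpace ℂ n →ₗ[ℂ] EuclideanSpace ℂ n) v
  rw [Matrix.coe_toEuclideanCLM_eq_toEuclideanLin, Matrix.toEuclideanLin_eq_toLin_orthonormal,
    Matrix.trace_toLin_eq] at h
  rw [h]
  simp [← Matrix.toEuclideanLin_eq_toLin_orthonormal,
    ← Matrix.coe_toEuclideanCLM_eq_toEuclideanLin]

-- Both squared norms equal `⟨x, b* b x⟩`. This takes the place of a polar decomposition in Hölder's
-- inequality.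
open scoped ComplexOrder MatrixOrder in
lemma norm_toEuclideanCLM_abs_apply (b : Matrix n n ℂ) (x : EuclideanSpace ℂ n) :
    ‖Matrix.toEuclideanCLM (n := n) (𝕜 := ℂ) (CFC.abs b) x‖ =
      ‖Matrix.toEuclideanCLM (n := n) (𝕜 := ℂ) b x‖ := by
  set T := Matrix.toEuclideanCLM (n := n) (𝕜 := ℂ)
  have key (c : Matrix n n ℂ) :
      inner ℂ (T c x) (T c x) = inner ℂ x (T (star c * c) x) := by
    rw [map_mul, map_star, ContinuousLinearMap.star_eq_adjoint,
      mul_apply_eq_comp, ContinuousLinearMap.adjoint_inner_right]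
  have h : star (CFC.abs b) * CFC.abs b = star b * b := by
    rw [(CFC.abs_nonneg b).isSelfAdjoint.star_eq, CFC.abs_mul_abs]
  have h2 : inner ℂ (T (CFC.abs b) x) (T (CFC.abs b) x) = inner ℂ (T b x) (T b x) := by
    rw [key, key, h]
  rw [inner_self_eq_norm_sq_to_K, inner_self_eq_norm_sq_to_K] at h2
  have h3 : ‖T (CFC.abs b) x‖ ^ 2 = ‖T b x‖ ^ 2 := by exact_mod_cast h2
  exact (sq_eq_sq₀ (norm_nonneg _) (norm_nonneg _)).1 h3

open scoped ComplexOrder MatrixOrder in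
/-- Hölder's inequality for the operator norm and the trace norm. -/
lemma norm_trace_mul_le (c b : Matrix n n ℂ) :
    ‖(c * b).trace‖ ≤ opNorm c * traceNorm b := by
  have hp : (CFC.abs b).PosSemidef := Matrix.nonneg_iff_posSemidef.1 (CFC.abs_nonneg b)
  -- In an eigenbasis of `|b|` the norms `‖b vᵢ‖` are the eigenvalues of `|b|`, which sum to the
  -- trace norm; Cauchy–Schwarz then bounds the trace termwise.
  set v := hp.isHermitian.eigenvectorBasis
  have hv (i : n) : ‖Matrix.toEuclideanCLM (n := n) (𝕜 := ℂ) b (v i)‖ =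
      hp.isHermitian.eigenvalues i := by
    have h : Matrix.toEuclideanCLM (n := n) (𝕜 := ℂ) (CFC.abs b) (v i) =
        (hp.isHermitian.eigenvalues i : ℂ) • v i := by
      apply WithLp.ofLp_injective
      simpa using hp.isHermitian.mulVec_eigenvectorBasis i
    rw [← norm_toEuclideanCLM_abs_apply, h, norm_smul, v.orthonormal.1 i, mul_one,
      Complex.norm_real, Real.norm_of_nonneg (hp.eigenvalues_nonneg i)]
  have ht : traceNorm b = ∑ i, hp.isHermitian.eigenvalues i := by
    rw [traceNorm, hp.isHermitian.trace_eq_sum_eigenvalues]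
    simp
  rw [trace_eq_sum_inner _ v, ht, Finset.mul_sum]
  refine (norm_sum_le _ _).trans (Finset.sum_le_sum fun i _ => ?_)
  calc _ ≤ ‖v i‖ * ‖Matrix.toEuclideanCLM (n := n) (𝕜 := ℂ) (c * b) (v i)‖ :=
        norm_inner_le_norm _ _
    _ = ‖Matrix.toEuclideanCLM (n := n) (𝕜 := ℂ) c
          (Matrix.toEuclideanCLM (n := n) (𝕜 := ℂ) b (v i))‖ := by
        rw [v.orthonormal.1 i, one_mul, map_mul, mul_apply_eq_comp]
    _ ≤ opNorm c * hp.isHermitian.eigenvalues i := by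
        rw [← hv i]
        exact ContinuousLinearMap.le_opNorm _ _

end TraceDuality

section ProjectiveNorm

variable {n : Type*} [Fintype n] [DecidableEq n]

/-- Ensures that the infimum defining `projNorm` is over a nonempty set, as `le_csInf` requires. -/
lemma exists_eq_sum_kronecker (x : Matrix (n × n) (n × n) ℂ) :
    ∃ (k : ℕ) (a b : Fin k → Matrix n n ℂ), x = ∑ i, a i ⊗ₖ b i := by
  let e := (Fintype.equivFin ((n × n) × (n × n))).symm
  refine ⟨_, fun i => x (e i).1 (e i).2 • Matrix.single (e i).1.1 (e i).2.1 1,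
    fun i => Matrix.single (e i).1.2 (e i).2.2 1, ?_⟩
  rw [e.sum_comp (fun p : (n × n) × (n × n) => (x p.1 p.2 • Matrix.single p.1.1 p.2.1 (1 : ℂ)) ⊗ₖ
    Matrix.single p.1.2 p.2.2 (1 : ℂ)), Fintype.sum_prod_type]
  conv_lhs => rw [Matrix.matrix_eq_sum_single x]
  refine Finset.sum_congr rfl fun p _ => Finset.sum_congr rfl fun q _ => ?_
  rw [Matrix.smul_kronecker, Matrix.single_kronecker_single, Matrix.smul_single]
  simp

lemma projNorm_nonneg (x : Matrix (n × n) (n × n) ℂ) : 0 ≤ projNorm x := by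
  refine Real.sInf_nonneg ?_
  rintro r ⟨k, a, b, -, rfl⟩
  exact Finset.sum_nonneg fun i _ => mul_nonneg (opNorm_nonneg _) (traceNorm_nonneg _)

lemma projNorm_kronecker_le (a b : Matrix n n ℂ) :
    projNorm (a ⊗ₖ b) ≤ opNorm a * traceNorm b := by
  refine csInf_le ⟨0, ?_⟩ ⟨1, fun _ => a, fun _ => b, by simp, by simp⟩
  rintro r ⟨k, a, b, -, rfl⟩
  exact Finset.sum_nonneg fun i _ => mul_nonneg (opNorm_nonneg _) (traceNorm_nonneg _)

/-- A bound for the trace pairing on elementary tensors extends to the projective norm. -/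
lemma norm_trace_mul_le_projNorm {ρ : Matrix (n × n) (n × n) ℂ} {C : ℝ} (hC : 0 < C)
    (h : ∀ a b : Matrix n n ℂ, ‖(ρ * a ⊗ₖ b).trace‖ ≤ C * (opNorm a * traceNorm b))
    (x : Matrix (n × n) (n × n) ℂ) : ‖(ρ * x).trace‖ ≤ C * projNorm x := by
  rw [← div_le_iff₀' hC]
  obtain ⟨k, a, b, hx⟩ := exists_eq_sum_kronecker x
  refine le_csInf ⟨_, k, a, b, hx, rfl⟩ ?_
  rintro r ⟨k, a, b, rfl, rfl⟩
  rw [div_le_iff₀' hC, Finset.mul_sum, Finset.mul_sum, Matrix.trace_sum]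
  exact (norm_sum_le _ _).trans (Finset.sum_le_sum fun i _ => h _ _)

end ProjectiveNorm

section SignedSwap

lemma wMinus_apply (p q : Fin 3 × Fin 3) :
    wMinus p q = if p.1 = q.2 ∧ p.2 = q.1 then (if p.1 = p.2 then 1 else -1) else 0 := by
  obtain ⟨i, j⟩ := p
  obtain ⟨k, l⟩ := q
  simp only [wMinus, Matrix.sum_apply, Fin.sum_univ_three]
  fin_cases i <;> fin_cases j <;> fin_cases k <;> fin_cases l <;> simp

lemma isSymmetry_wMinus : IsSymmetry wMinus := by
  have hs : star wMinus = wMinus := by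
    ext p q
    rw [Matrix.star_apply, wMinus_apply, wMinus_apply]
    obtain ⟨i, j⟩ := p
    obtain ⟨k, l⟩ := q
    by_cases h1 : i = l <;> by_cases h2 : j = k <;> by_cases h3 : i = j <;>
      simp_all [eq_comm]
  refine ⟨hs, Matrix.mem_unitaryGroup_iff.2 ?_⟩
  rw [hs]
  ext p q
  obtain ⟨i, j⟩ := p
  obtain ⟨k, l⟩ := q
  rw [Matrix.mul_apply, Fintype.sum_eq_single (j, i)]
  · rw [wMinus_apply, wMinus_apply, Matrix.one_apply]
    by_cases h1 : i = k <;> by_cases h2 : j = l <;> by_cases h3 : i = j <;>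
      simp_all [eq_comm]
  · rintro ⟨s, t⟩ hst
    rw [wMinus_apply (i, j), if_neg, zero_mul]
    rintro ⟨rfl, rfl⟩
    exact hst rfl

lemma not_isBlockPositive_wMinus : ¬ IsBlockPositive wMinus := by
  intro h
  -- On the all-ones product vector the form is the sum of all `ε_ij`, namely `3 - 6 = -3`.
  have h1 := (Complex.le_def.1 (h (fun _ => 1) (fun _ => 1))).1
  simp [dotProduct, Matrix.mulVec, tensorVec, wMinus_apply, Fintype.sum_prod_type,
    Fin.sum_univ_three] at h1
  norm_num at h1

/-- The Schur multiplier keeping the diagonal and changing the sign of the other entries. -/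
def flipOffDiag (a : Matrix (Fin 3) (Fin 3) ℂ) : Matrix (Fin 3) (Fin 3) ℂ :=
  Matrix.of fun i j => if i = j then a i j else -a i j

lemma trace_wMinus_mul_kronecker (a b : Matrix (Fin 3) (Fin 3) ℂ) :
    (wMinus * a ⊗ₖ b).trace = (flipOffDiag a * b).trace := by
  simp [Matrix.trace, Matrix.mul_apply, wMinus_apply, flipOffDiag, Fintype.sum_prod_type,
    Fin.sum_univ_three]
  ring

lemma exists_cube_root : ∃ ω : ℂ, ω * star ω = 1 ∧ star ω = ω ^ 2 ∧ 1 + ω + ω ^ 2 = 0 := by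
  have hω := Complex.isPrimitiveRoot_exp 3 (by norm_num)
  set ω := Complex.exp (2 * Real.pi * Complex.I / (3 : ℕ))
  have h3 : ω ^ 3 = 1 := hω.pow_eq_one
  have hn : ω * star ω = 1 := by
    have : ‖ω‖ = 1 := Complex.norm_eq_one_of_pow_eq_one h3 (by norm_num)
    change ω * (starRingEnd ℂ) ω = 1
    rw [Complex.mul_conj, Complex.normSq_eq_norm_sq, this]
    norm_num
  have h0 : ω ≠ 0 := left_ne_zero_of_mul_eq_one hn
  refine ⟨ω, hn, mul_left_cancel₀ h0 ?_, ?_⟩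
  · rw [hn, ← h3]
    ring
  · simpa [Finset.sum_range_succ] using hω.geom_sum_eq_zero (by norm_num)

lemma opNorm_flipOffDiag_le (a : Matrix (Fin 3) (Fin 3) ℂ) :
    opNorm (flipOffDiag a) ≤ 5 / 3 * opNorm a := by
  obtain ⟨ω, hn, hs, h0⟩ := exists_cube_root
  have h3 : ω ^ 3 = 1 := by rw [← hn, hs]; ring
  set u : Matrix (Fin 3) (Fin 3) ℂ := Matrix.diagonal ![1, ω, ω ^ 2] with hu_def
  have hstar : star u = Matrix.diagonal ![1, ω ^ 2, ω] := by
    rw [Matrix.star_eq_conjTranspose, hu_def, Matrix.diagonal_conjTranspose]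
    congr 1
    ext i
    fin_cases i
    · simp
    · simpa using hs
    · have : star (ω ^ 2) = ω := by rw [← hs, star_star]
      simpa using this
  have hu : u ∈ Matrix.unitaryGroup (Fin 3) ℂ := by
    rw [Matrix.mem_unitaryGroup_iff, hstar, hu_def, Matrix.diagonal_mul_diagonal,
      ← Matrix.diagonal_one]
    congr 1
    ext i
    fin_cases i
    · simp
    · simpa [← pow_succ'] using h3
    · simpa [← pow_succ] using h3
  -- Conjugation by `u` multiplies entry `(i, j)` by `ω^(i-j)`. The total factor is `-1/3 + 4/3 = 1`
  -- on the diagonal and `-1/3 + (2/3)(ω + ω²) = -1` off it.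
  have hflip : flipOffDiag a = (-1 / 3 : ℂ) • a + (2 / 3 : ℂ) • (u * a * star u) +
      (2 / 3 : ℂ) • (star u * a * star (star u)) := by
    rw [star_star, hstar, hu_def]
    ext i j
    simp only [flipOffDiag, Matrix.of_apply, Matrix.add_apply, Matrix.smul_apply,
      Matrix.diagonal_mul, Matrix.mul_diagonal, smul_eq_mul]
    fin_cases i <;> fin_cases j <;> simp <;> grind
  have n1 : ‖(-1 / 3 : ℂ)‖ = 1 / 3 := by norm_num
  have n2 : ‖(2 / 3 : ℂ)‖ = 2 / 3 := by norm_num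
  have e1 := opNorm_unitary_conj_le hu a
  have e2 := opNorm_unitary_conj_le (Unitary.star_mem hu) a
  rw [hflip]
  refine (opNorm_add_le _ _).trans ((add_le_add_left (opNorm_add_le _ _) _).trans ?_)
  rw [opNorm_smul, opNorm_smul, opNorm_smul, n1, n2]
  linarith

lemma norm_trace_wMinus_mul_le (x : Matrix (Fin 3 × Fin 3) (Fin 3 × Fin 3) ℂ) :
    ‖(wMinus * x).trace‖ ≤ 5 / 3 * projNorm x := by
  refine norm_trace_mul_le_projNorm (by norm_num) (fun a b => ?_) x
  rw [trace_wMinus_mul_kronecker, ← mul_assoc]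
  exact (norm_trace_mul_le _ _).trans
    (mul_le_mul_of_nonneg_right (opNorm_flipOffDiag_le a) (traceNorm_nonneg b))

/-- The rank one projection onto the constant vectors of `ℂ³`. -/
noncomputable def constProj : Matrix (Fin 3) (Fin 3) ℂ := Matrix.of fun _ _ => 1 / 3

lemma conjTranspose_constProj : constProj.conjTranspose = constProj := by
  ext i j
  simp [constProj]

lemma constProj_mul_self : constProj * constProj = constProj := by
  ext i j
  norm_num [constProj, Matrix.mul_apply]

open scoped ComplexOrder in
lemma traceNorm_constProj : traceNorm constProj = 1 := by
  have h : constProj.PosSemidef := by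
    have := Matrix.posSemidef_conjTranspose_mul_self constProj
    rwa [conjTranspose_constProj, constProj_mul_self] at this
  rw [traceNorm_of_posSemidef h]
  norm_num [Matrix.trace, constProj]

lemma reflection_mem_unitaryGroup :
    (2 : ℂ) • constProj - 1 ∈ Matrix.unitaryGroup (Fin 3) ℂ := by
  rw [Matrix.mem_unitaryGroup_iff, Matrix.star_eq_conjTranspose, Matrix.conjTranspose_sub,
    Matrix.conjTranspose_smul, conjTranspose_constProj, Matrix.conjTranspose_one, star_ofNat,
    sub_mul, mul_sub, smul_mul_smul_comm, constProj_mul_self]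
  ext i j
  simp
  ring

lemma trace_wMinus_mul_reflection :
    (wMinus * ((2 : ℂ) • constProj - 1) ⊗ₖ constProj).trace = -(5 / 3) := by
  rw [trace_wMinus_mul_kronecker]
  simp [Matrix.trace, Matrix.mul_apply, flipOffDiag, constProj, Fin.sum_univ_three,
    Matrix.one_apply]
  norm_num

lemma alphaNorm_wMinus : alphaNorm wMinus = 5 / 3 := by
  refine IsGreatest.csSup_eq ⟨⟨((2 : ℂ) • constProj - 1) ⊗ₖ constProj, ?_, ?_⟩, ?_⟩
  · intro h
    have := trace_wMinus_mul_reflection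
    rw [h] at this
    norm_num at this
  · have hle : projNorm (((2 : ℂ) • constProj - 1) ⊗ₖ constProj) ≤ 1 := by
      refine (projNorm_kronecker_le _ _).trans ?_
      rw [traceNorm_constProj, mul_one]
      exact opNorm_le_one_of_mem_unitaryGroup reflection_mem_unitaryGroup
    have hge := norm_trace_wMinus_mul_le (((2 : ℂ) • constProj - 1) ⊗ₖ constProj)
    have hn : ‖(wMinus * ((2 : ℂ) • constProj - 1) ⊗ₖ constProj).trace‖ = 5 / 3 := by
      rw [trace_wMinus_mul_reflection]
      norm_num
    rw [hn] at hge ⊢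
    -- The upper bound on the pairing forces the witness to have projective norm at least `1`, hence
    -- exactly `1`.
    rw [le_antisymm hle (by linarith), div_one]
  · rintro r ⟨x, -, rfl⟩
    -- Division by zero gives `0`, so definiteness of `projNorm` is not needed.
    exact div_le_of_le_mul₀ (projNorm_nonneg x) (by norm_num) (norm_trace_wMinus_mul_le x)

end SignedSwap

theorem mainTheorem6 :
    IsSymmetry wMinus ∧ ¬ IsBlockPositive wMinus ∧ alphaNorm wMinus = 5 / 3 :=
  ⟨isSymmetry_wMinus, not_isBlockPositive_wMinus, alphaNorm_wMinus⟩
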